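/- Let $\Lambda$ be a field of characteristic $\neq 2$, or $\Lambda=\mathbb Z/2\mathbb Z$, with an involution $x\mapsto\bar x$; let $q$ be a non-negative integer and $\epsilon=(-1)^q$. Based modules and simple isomorphisms are taken with respect to the full group $Z=\widetilde K_1(\Lambda)=\operatorname{coker}(K_1(\mathbb Z)\to K_1(\Lambda))$. For a $\Lambda$-module $M$, an $\epsilon$-quadratic form on $M$ is an element of $Q_\epsilon(M)=\operatorname{coker}(1-T_\epsilon)$, where $(T_\epsilon\phi)(x)(y)=\epsilon\,\overline{\phi(y)(x)}$ for $\phi\in\operatorname{Hom}_\Lambda(M,M^*)$. Let $H_\epsilon(\Lambda^k)=\Lambda^k\oplus(\Lambda^k)^*$ be the hyperbolic form, represented by $\begin{pmatrix}0&1\\0&0\end{pmatrix}$. Let $RU_k(\Lambda,\epsilon)$ be the group generated by the simple isometries of $H_\epsilon(\Lambda^k)$ that map $\Lambda^k\times\{0\}$ onto itself by a simple automorphism, together with the flip $\begin{pmatrix}0&1\\ \epsilon&0\end{pmatrix}$ of the first hyperbolic plane (if $k\ge1$). Let $l_{2q+1}(\Lambda)$ be the set of equivalence classes of pairs $(H_\epsilon(\Lambda^k),V)$,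 $k\ge 0$, where $V\subset\Lambda^{2k}$ is a based free direct summand of rank $k$, and where $(H_\epsilon(\Lambda^k),V)$ and $(H_\epsilon(\Lambda^l),V')$ are equivalent if for some $n\ge k,l$ there is $\tau\in RU_n(\Lambda,\epsilon)$ with $\tau(V\oplus(\Lambda^{n-k}\times\{0\}))=V'\oplus(\Lambda^{n-l}\times\{0\})$ as based modules. A pair is elementary if $V\oplus(\{0\}\times\Lambda^k)=\Lambda^{2k}$ as based modules, and an element of $l_{2q+1}(\Lambda)$ is elementary if it is represented by an elementary pair. Then every element of $l_{2q+1}(\Lambda)$ is elementary. -/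

import Mathlib

/-! # The monoid `l_{2q+1}(Λ)` and its elementary elements

`Λ` is a commutative ring with an involution `star`. -/

namespace KreckMonoid

section ReducedK1

variable (Λ : Type*) [CommRing Λ]

/-- The free abelian group on all invertible matrices of all finite sizes. -/
abbrev FreeOnGL : Type _ :=
  FreeAbelianGroup (Σ n : ℕ, Matrix.GeneralLinearGroup (Fin n) Λ)

/-- The relations `[A B] = [A] + [B]` and `[A ⊕ 1] = [A]`; dividing by them produces
`K₁(Λ)`, the abelianisation of `GL(Λ) = colim GLₙ(Λ)`. -/
def k1Relations : Set (FreeOnGL Λ) :=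
  {r | ∃ (n : ℕ) (A B : Matrix.GeneralLinearGroup (Fin n) Λ),
      r = FreeAbelianGroup.of ⟨n, A * B⟩
        - (FreeAbelianGroup.of ⟨n, A⟩ + FreeAbelianGroup.of ⟨n, B⟩)} ∪
  {r | ∃ (n : ℕ) (A : Matrix.GeneralLinearGroup (Fin n) Λ)
      (B : Matrix.GeneralLinearGroup (Fin (n + 1)) Λ),
      (B : Matrix (Fin (n + 1)) (Fin (n + 1)) Λ) =
        Matrix.reindex finSumFinEquiv finSumFinEquiv
          (Matrix.fromBlocks (A : Matrix (Fin n) (Fin n) Λ) 0 0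
            (1 : Matrix (Fin 1) (Fin 1) Λ)) ∧
      r = FreeAbelianGroup.of ⟨n + 1, B⟩ - FreeAbelianGroup.of ⟨n, A⟩}

/-- The classes of invertible integral matrices, which generate the image of `K₁(ℤ)`. -/
def integralClasses : Set (FreeOnGL Λ) :=
  {r | ∃ (n : ℕ) (A : Matrix.GeneralLinearGroup (Fin n) ℤ),
      r = FreeAbelianGroup.of
        ⟨n, Matrix.GeneralLinearGroup.map (Int.castRingHom Λ) A⟩}

/-- The reduced group `coker (K₁(ℤ) → K₁(Λ))`. -/
abbrev ReducedK1 : Type _ :=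
  FreeOnGL Λ ⧸ AddSubgroup.closure (k1Relations Λ ∪ integralClasses Λ)

variable {Λ}

/-- The class of an invertible matrix in the reduced `K₁`-group. -/
def torsionClass {n : ℕ} (A : Matrix.GeneralLinearGroup (Fin n) Λ) : ReducedK1 Λ :=
  QuotientAddGroup.mk (FreeAbelianGroup.of ⟨n, A⟩)

/-- A square matrix is `Z`-simple if it is invertible and its class lies in `Z`. -/
def IsSimpleMatrix (Z : AddSubgroup (ReducedK1 Λ)) {n : ℕ}
    (A : Matrix (Fin n) (Fin n) Λ) : Prop :=
  ∃ U : Matrix.GeneralLinearGroup (Fin n) Λ,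
    (U : Matrix (Fin n) (Fin n) Λ) = A ∧ torsionClass U ∈ Z

/-- The families `b` and `c` are related by a `Z`-simple change of basis. For linearly
independent families this says that they span the same submodule and that, as bases of
this submodule, they are `Z`-equivalent. -/
def SameBasedSpan (Z : AddSubgroup (ReducedK1 Λ)) {M : Type*} [AddCommGroup M] [Module Λ M]
    {n : ℕ} (b c : Fin n → M) : Prop :=
  ∃ A : Matrix (Fin n) (Fin n) Λ, IsSimpleMatrix Z A ∧ ∀ i, b i = ∑ j, A j i • c j

end ReducedK1

section Forms

variable {Λ : Type*} [CommRing Λ] [StarRing Λ]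

/-- Asymmetric forms `M → M*`, i.e. sesquilinear forms on `M`, conjugate-linear in the
first variable and linear in the second. -/
abbrev Form (Λ : Type*) [CommRing Λ] [StarRing Λ] (M : Type*) [AddCommGroup M] [Module Λ M] :
    Type _ :=
  M →ₗ⋆[Λ] M →ₗ[Λ] Λ

/-- The sign `ε = (-1)^q`. -/
def sign (Λ : Type*) [CommRing Λ] (q : ℕ) : Λ := (-1) ^ q

lemma star_sign (q : ℕ) : star (sign Λ q) = sign Λ q := by
  simp [sign]

lemma sign_mul_self {Λ : Type*} [CommRing Λ] (q : ℕ) : sign Λ q * sign Λ q = 1 := by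
  simp [sign, ← mul_pow]

variable {M : Type*} [AddCommGroup M] [Module Λ M]

/-- The `ε`-duality involution `(T_ε φ)(x)(y) = ε * star (φ(y)(x))`. -/
def duality (q : ℕ) (φ : Form Λ M) : Form Λ M :=
  LinearMap.mk₂'ₛₗ (starRingEnd Λ) (RingHom.id Λ)
    (fun x y => sign Λ q * star (φ y x))
    (by intro x x' y; simp [mul_add])
    (by intro c x y; simp [starRingEnd_apply]; ring)
    (by intro x y y'; simp [mul_add])
    (by intro c x y; simp [starRingEnd_apply]; ring)

/-- The image of the homomorphism `1 - T_ε`. -/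
def imOneSubDuality (Λ : Type*) [CommRing Λ] [StarRing Λ] (M : Type*) [AddCommGroup M]
    [Module Λ M] (q : ℕ) : AddSubgroup (Form Λ M) where
  carrier := Set.range fun φ : Form Λ M => φ - duality q φ
  zero_mem' := ⟨0, by ext x y; simp [duality]⟩
  add_mem' := by
    rintro _ _ ⟨φ, rfl⟩ ⟨φ', rfl⟩
    exact ⟨φ + φ', by ext x y; simp [duality]; ring⟩
  neg_mem' := by
    rintro _ ⟨φ, rfl⟩
    exact ⟨-φ, by ext x y; simp [duality]; ring⟩

/-- The group `Q_ε(M) = coker (1 - T_ε)` of `ε`-quadratic forms on `M`. -/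
abbrev QuadForms (Λ : Type*) [CommRing Λ] [StarRing Λ] (M : Type*) [AddCommGroup M]
    [Module Λ M] (q : ℕ) : Type _ :=
  Form Λ M ⧸ imOneSubDuality Λ M q

/-- The pull-back `f^* ψ f` of a sesquilinear form. -/
def pullback (ψ : Form Λ M) (f : M →ₗ[Λ] M) : Form Λ M :=
  LinearMap.mk₂'ₛₗ (starRingEnd Λ) (RingHom.id Λ) (fun x y => ψ (f x) (f y))
    (by intro x x' y; simp)
    (by intro c x y; simp)
    (by intro x y y'; simp)
    (by intro c x y; simp)

/-- `f` preserves the `ε`-quadratic form represented by `ψ`. -/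
def IsIsometry (q : ℕ) (ψ : Form Λ M) (f : M ≃ₗ[Λ] M) : Prop :=
  (QuotientAddGroup.mk (pullback ψ f.toLinearMap) : QuadForms Λ M q) =
    (QuotientAddGroup.mk ψ : QuadForms Λ M q)

end Forms

section Hyperbolic

variable (Λ : Type*) [CommRing Λ] [StarRing Λ]

/-- The module `Λ^k ⊕ (Λ^k)^*` underlying `H_ε(Λ^k)`, with `(Λ^k)^*` identified with `Λ^k`
by the dual basis. -/
abbrev Hyp (k : ℕ) : Type _ := (Fin k → Λ) × (Fin k → Λ)

/-- The form `(0 1; 0 0)` on `Λ^k ⊕ (Λ^k)^*`: `ψ((x, a), (y, b)) = a(y)`. An element `a` of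
`(Λ^k)^*` with coordinates `aᵢ` in the dual basis is `y ↦ ∑ᵢ yᵢ * star aᵢ`, as `Λ` acts on the
dual module through the involution. It represents the hyperbolic `ε`-quadratic form. -/
def hypForm (k : ℕ) : Form Λ (Hyp Λ k) :=
  LinearMap.mk₂'ₛₗ (starRingEnd Λ) (RingHom.id Λ)
    (fun u v => ∑ i, star (u.2 i) * v.1 i)
    (by intro u u' v; simp [add_mul, Finset.sum_add_distrib])
    (by intro c u v; simp [starRingEnd_apply, Finset.mul_sum, mul_comm, mul_left_comm])
    (by intro u v v'; simp [mul_add, Finset.sum_add_distrib])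
    (by intro c u v; simp [Finset.mul_sum, mul_left_comm])

/-- The standard basis of `Λ^k ⊕ Λ^k`. -/
noncomputable def stdBasis (k : ℕ) : Module.Basis (Fin (k + k)) Λ (Hyp Λ k) :=
  ((Pi.basisFun Λ (Fin k)).prod (Pi.basisFun Λ (Fin k))).reindex finSumFinEquiv

/-- The Lagrangian `Λ^k × {0}`. -/
def stdLagrangian (k : ℕ) : Submodule Λ (Hyp Λ k) := Submodule.prod ⊤ ⊥

/-- The Lagrangian `{0} × Λ^k`. -/
def dualLagrangian (k : ℕ) : Submodule Λ (Hyp Λ k) := Submodule.prod ⊥ ⊤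

variable {Λ}

/-- `SU_k(Λ, ε)`: the simple isometries of `H_ε(Λ^k)`. -/
def SU (q : ℕ) (Z : AddSubgroup (ReducedK1 Λ)) (k : ℕ) : Set (Hyp Λ k ≃ₗ[Λ] Hyp Λ k) :=
  {f | IsIsometry q (hypForm Λ k) f ∧
    IsSimpleMatrix Z (LinearMap.toMatrix (stdBasis Λ k) (stdBasis Λ k) f.toLinearMap)}

/-- `TU_k(Λ, ε)`: the simple isometries preserving `Λ^k × {0}` and inducing a simple
automorphism of it. -/
def TU (q : ℕ) (Z : AddSubgroup (ReducedK1 Λ)) (k : ℕ) : Set (Hyp Λ k ≃ₗ[Λ] Hyp Λ k) :=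
  {f | f ∈ SU q Z k ∧
    (stdLagrangian Λ k).map f.toLinearMap = stdLagrangian Λ k ∧
    IsSimpleMatrix Z (LinearMap.toMatrix'
      (LinearMap.fst Λ (Fin k → Λ) (Fin k → Λ) ∘ₗ f.toLinearMap ∘ₗ
        LinearMap.inl Λ (Fin k → Λ) (Fin k → Λ)))}

/-- The flip `(0 1; ε 0)` on the `i`-th hyperbolic plane, the identity on the others. -/
def flip (q : ℕ) {k : ℕ} (i : Fin k) : Hyp Λ k ≃ₗ[Λ] Hyp Λ k where
  toFun u := (fun j => if j = i then u.2 j else u.1 j,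
    fun j => if j = i then sign Λ q * u.1 j else u.2 j)
  invFun u := (fun j => if j = i then sign Λ q * u.2 j else u.1 j,
    fun j => if j = i then u.1 j else u.2 j)
  map_add' u v := by
    ext j <;> by_cases h : j = i <;> simp [h, mul_add]
  map_smul' c u := by
    ext j <;> by_cases h : j = i <;> simp [h, mul_left_comm]
  left_inv u := by
    ext j <;> by_cases h : j = i <;> simp [h, ← mul_assoc, sign_mul_self]
  right_inv u := by
    ext j <;> by_cases h : j = i <;> simp [h, ← mul_assoc, sign_mul_self]

/-- `RU_k(Λ, ε)`: the group generated by `TU_k(Λ, ε)` and the flip `σ_k` of the first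
hyperbolic plane (if there is one). -/
def RU (q : ℕ) (Z : AddSubgroup (ReducedK1 Λ)) (k : ℕ) :
    Subgroup (Hyp Λ k ≃ₗ[Λ] Hyp Λ k) :=
  Subgroup.closure (TU q Z k ∪ {f | ∃ h : 0 < k, f = flip q ⟨0, h⟩})

/-- The inclusion `Λ^k → Λ^n` onto the first coordinates. -/
def extend {k : ℕ} (n : ℕ) (x : Fin k → Λ) : Fin n → Λ :=
  fun j => if h : (j : ℕ) < k then x ⟨j, h⟩ else 0

variable (Λ)

/-- A pair `(H_ε(Λ^k), V)`: a based free direct summand `V ⊆ Λ^{2k}` of rank `k`. Pairs whose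
bases are `Z`-equivalent become equal in the quotient below. -/
structure Pair where
  k : ℕ
  V : Submodule Λ (Hyp Λ k)
  basis : Module.Basis (Fin k) Λ V
  summand : ∃ W : Submodule Λ (Hyp Λ k), IsCompl V W

variable {Λ}

/-- The basis of `V ⊕ (Λ^{n-k} × {0}) ⊆ Λ^{2n}` made up of the basis of `V` and the standard
basis of `Λ^{n-k}`, for `k ≤ n`. -/
noncomputable def Pair.stabBasis (p : Pair Λ) (n : ℕ) : Fin n → Hyp Λ n :=
  fun i => if h : (i : ℕ) < p.k then
      (extend n (p.basis ⟨i, h⟩ : Hyp Λ p.k).1, extend n (p.basis ⟨i, h⟩ : Hyp Λ p.k).2)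
    else (Pi.single i 1, 0)

/-- `(H_ε(Λ^k), V)` and `(H_ε(Λ^l), V')` are equivalent if, for some `n` and some
`τ ∈ RU_n(Λ, ε)`, `τ(V ⊕ (Λ^{n-k} × {0})) = V' ⊕ (Λ^{n-l} × {0})` as based modules. -/
def Pair.Equivalent (q : ℕ) (Z : AddSubgroup (ReducedK1 Λ)) (p p' : Pair Λ) : Prop :=
  ∃ n : ℕ, p.k ≤ n ∧ p'.k ≤ n ∧ ∃ τ ∈ RU q Z n,
    SameBasedSpan Z (fun i => τ (p.stabBasis n i)) (p'.stabBasis n)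

/-- A pair `(H_ε(Λ^k), V)` is elementary if `V ⊕ ({0} × Λ^k) = Λ^{2k}` as based modules. -/
def Pair.IsElementary (Z : AddSubgroup (ReducedK1 Λ)) (p : Pair Λ) : Prop :=
  IsCompl p.V (dualLagrangian Λ p.k) ∧
  IsSimpleMatrix Z ((stdBasis Λ p.k).toMatrix
    (Fin.append (fun i => (p.basis i : Hyp Λ p.k))
      (fun i => ((0, Pi.single i 1) : Hyp Λ p.k))))

/-- The set `l_{2q+1}(Λ)` of equivalence classes of pairs, with respect to the subgroup `Z` of
the reduced `K₁`-group. -/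
def OddMonoid (Λ : Type*) [CommRing Λ] [StarRing Λ] (q : ℕ) (Z : AddSubgroup (ReducedK1 Λ)) :
    Type _ :=
  Quot (Pair.Equivalent (Λ := Λ) q Z)

/-- An element of `l_{2q+1}(Λ)` is elementary if it has an elementary representative. -/
def OddMonoid.IsElementary {q : ℕ} {Z : AddSubgroup (ReducedK1 Λ)} (x : OddMonoid Λ q Z) :
    Prop :=
  ∃ p : Pair Λ, Quot.mk _ p = x ∧ p.IsElementary Z

end Hyperbolic

end KreckMonoid

namespace KreckMonoid

/-! ### Hyperbolic isometries induced by automorphisms of `Λ^n` -/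

section CommRing

variable {Λ : Type*} [CommRing Λ]

/-! Since `Z` is the full group, simple just means invertible, so over a field a pair is elementary
as soon as `V` meets `{0} × Λ^k` trivially: dimensions do the rest
(`Pair.isElementary_of_inf_eq_bot`). It remains to reach this position by `RU_k`, without
stabilizing.

If `(0, a) ∈ V` with `a ≠ 0`, the projection `P` of `V` to `Λ^k` is not onto, because `dim V = k`.
Choose `e` outside both `P` and `ker a`, and `g` carrying `e` to the first unit vector and `P` into
the span of the others. Apply `g ⊕ (g⁻¹)^*`, then the flip. A vector of `V` landing in `{0} × Λ^k`
already lay there, and its functional kills `e`; as `a` does not, the intersection has become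
smaller (`exists_mem_RU_finrank_inf_lt`). Now induct on its dimension. -/

lemma isSimpleMatrix_top {n : ℕ} {A : Matrix (Fin n) (Fin n) Λ} (hA : IsUnit A) :
    IsSimpleMatrix (⊤ : AddSubgroup (ReducedK1 Λ)) A :=
  ⟨hA.unit, rfl, AddSubgroup.mem_top _⟩

lemma extend_self {k : ℕ} (x : Fin k → Λ) : extend k x = x := by
  ext j
  simp [extend]

lemma isUnit_toMatrix' {n : ℕ} (g : (Fin n → Λ) ≃ₗ[Λ] (Fin n → Λ)) :
    IsUnit (LinearMap.toMatrix' g.toLinearMap) :=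
  IsUnit.of_mul_eq_one (LinearMap.toMatrix' g.symm.toLinearMap)
    (by rw [← LinearMap.toMatrix'_comp]; simp)

lemma stabBasis_self (p : Pair Λ) (i : Fin p.k) : p.stabBasis p.k i = p.basis i := by
  simp [Pair.stabBasis, extend_self]

variable [StarRing Λ]

/-- The hyperbolic isometry `(g, (g⁻¹)^*)` of `H_ε(Λ^n)` induced by an automorphism `g`
of `Λ^n`. -/
noncomputable def hyperbolicEquiv {n : ℕ} (g : (Fin n → Λ) ≃ₗ[Λ] (Fin n → Λ)) :
    Hyp Λ n ≃ₗ[Λ] Hyp Λ n :=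
  g.prodCongr (Matrix.toLin'OfInv
    (M' := (LinearMap.toMatrix' g.symm.toLinearMap).conjTranspose)
    (M := (LinearMap.toMatrix' g.toLinearMap).conjTranspose)
    (by rw [← Matrix.conjTranspose_mul, ← LinearMap.toMatrix'_comp]; simp)
    (by rw [← Matrix.conjTranspose_mul, ← LinearMap.toMatrix'_comp]; simp))

lemma hyperbolicEquiv_fst {n : ℕ} (g : (Fin n → Λ) ≃ₗ[Λ] (Fin n → Λ)) (u : Hyp Λ n) :
    (hyperbolicEquiv g u).1 = g u.1 := rfl

lemma hyperbolicEquiv_snd {n : ℕ} (g : (Fin n → Λ) ≃ₗ[Λ] (Fin n → Λ)) (u : Hyp Λ n) :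
    (hyperbolicEquiv g u).2 =
      (LinearMap.toMatrix' g.symm.toLinearMap).conjTranspose.mulVec u.2 := by
  rw [← Matrix.toLin'_apply]
  rfl

lemma hypForm_apply {n : ℕ} (u v : Hyp Λ n) : hypForm Λ n u v = star u.2 ⬝ᵥ v.1 := rfl

/-- The second component, read as a functional, is precomposed with `g⁻¹`. This gives invariance of
the form, and later identifies a coordinate of the image with a value at `e`. -/
lemma star_hyperbolicEquiv_snd {n : ℕ} (g : (Fin n → Λ) ≃ₗ[Λ] (Fin n → Λ)) (u : Hyp Λ n)
    (y : Fin n → Λ) : star (hyperbolicEquiv g u).2 ⬝ᵥ y = star u.2 ⬝ᵥ g.symm y := by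
  rw [hyperbolicEquiv_snd, Matrix.star_mulVec, Matrix.conjTranspose_conjTranspose,
    ← Matrix.dotProduct_mulVec, LinearMap.toMatrix'_mulVec]
  rfl

lemma hyperbolicEquiv_mem_TU (q : ℕ) {n : ℕ} (g : (Fin n → Λ) ≃ₗ[Λ] (Fin n → Λ)) :
    hyperbolicEquiv g ∈ TU q (⊤ : AddSubgroup (ReducedK1 Λ)) n := by
  refine ⟨⟨?_, isSimpleMatrix_top ?_⟩, ?_, isSimpleMatrix_top (isUnit_toMatrix' g)⟩
  -- The representing form is preserved on the nose, not only modulo the image of `1 - T_ε`.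
  · refine congrArg _ (LinearMap.ext fun u => LinearMap.ext fun v => ?_)
    change hypForm Λ n (hyperbolicEquiv g u) (hyperbolicEquiv g v) = hypForm Λ n u v
    rw [hypForm_apply, star_hyperbolicEquiv_snd, hyperbolicEquiv_fst, g.symm_apply_apply]
    rfl
  · exact IsUnit.of_mul_eq_one
      (LinearMap.toMatrix (stdBasis Λ n) (stdBasis Λ n) (hyperbolicEquiv g).symm.toLinearMap)
      (by rw [← LinearMap.toMatrix_comp]; simp)
  · ext u
    constructor
    · rintro ⟨v, ⟨-, hv⟩, rfl⟩
      refine ⟨trivial, ?_⟩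
      have hv : v.2 = 0 := hv
      change (hyperbolicEquiv g v).2 = 0
      rw [hyperbolicEquiv_snd, hv, Matrix.mulVec_zero]
    · rintro ⟨-, hu⟩
      have hu : u.2 = 0 := hu
      refine ⟨(g.symm u.1, 0), ⟨trivial, rfl⟩, Prod.ext (g.apply_symm_apply _) ?_⟩
      change (hyperbolicEquiv g (g.symm u.1, 0)).2 = u.2
      rw [hyperbolicEquiv_snd, hu, Matrix.mulVec_zero]

end CommRing

/-! ### General position with respect to `{0} × Λ^n` over a field -/

section Field

variable {Λ : Type*} [Field Λ]

/-- A vector outside a subspace can be moved to the `i`-th unit vector such that the subspace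
is moved into the span of the other unit vectors. -/
lemma exists_linearEquiv_single {n : ℕ} (i : Fin n) (P : Submodule Λ (Fin n → Λ))
    {e : Fin n → Λ} (he : e ∉ P) :
    ∃ g : (Fin n → Λ) ≃ₗ[Λ] (Fin n → Λ), g e = Pi.single i 1 ∧ ∀ x ∈ P, g x i = 0 := by
  obtain ⟨f, hfe, hfP⟩ := Submodule.exists_le_ker_of_notMem he
  set φ : (Fin n → Λ) →ₗ[Λ] Λ := (f e)⁻¹ • f with hφ
  have hφe : φ e = 1 := by simp [hφ, hfe]
  have hφP : ∀ x ∈ P, φ x = 0 := fun x hx => by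
    have : f x = 0 := hfP hx
    simp [hφ, this]
  let π : (Fin n → Λ) →ₗ[Λ] Λ := LinearMap.proj i
  have hπ : π (Pi.single i 1) = 1 := by simp [π]
  have hdim : Module.finrank Λ (LinearMap.ker φ) = Module.finrank Λ (LinearMap.ker π) := by
    have key : ∀ (ψ : (Fin n → Λ) →ₗ[Λ] Λ) (v : Fin n → Λ), ψ v = 1 →
        1 + Module.finrank Λ (LinearMap.ker ψ) = n := fun ψ v hv => by
      have h := LinearMap.finrank_range_add_finrank_ker ψ
      rw [LinearMap.range_eq_top.2 (LinearMap.surjective (f := ψ)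
        (fun h => by simp [h] at hv))] at h
      simpa using h
    have h1 := key φ e hφe
    have h2 := key π _ hπ
    omega
  let κ := LinearEquiv.ofFinrankEq _ _ hdim
  -- The projection onto `ker φ` along `e`; `G` then matches the splittings `⟨e⟩ ⊕ ker φ` and
  -- `⟨Pi.single i 1⟩ ⊕ ker π`.
  let ρ : (Fin n → Λ) →ₗ[Λ] LinearMap.ker φ :=
    (LinearMap.id - φ.smulRight e).codRestrict _ (fun x => by simp [hφe])
  have hρ : ∀ x, (ρ x : Fin n → Λ) = x - φ x • e := fun x => rfl
  let G : (Fin n → Λ) →ₗ[Λ] (Fin n → Λ) :=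
    φ.smulRight (Pi.single i 1) + (LinearMap.ker π).subtype ∘ₗ κ.toLinearMap ∘ₗ ρ
  have hG : ∀ x, G x = φ x • Pi.single i 1 + (κ (ρ x) : Fin n → Λ) := fun x => rfl
  have hGi : ∀ x, G x i = φ x := fun x => by
    have h : (κ (ρ x) : Fin n → Λ) i = 0 := (κ (ρ x)).2
    simp [hG, h]
  have hinj : Function.Injective G := by
    rw [← LinearMap.ker_eq_bot, LinearMap.ker_eq_bot']
    intro x hx
    have h1 : φ x = 0 := by rw [← hGi, hx]; rfl
    have h2 : κ (ρ x) = 0 := by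
      have := hG x
      rw [hx, h1, zero_smul, zero_add] at this
      exact Subtype.ext this.symm
    have h3 : ((ρ x : LinearMap.ker φ) : Fin n → Λ) = 0 := by
      rw [(LinearEquiv.map_eq_zero_iff κ).1 h2]; rfl
    simpa [hρ, h1] using h3
  refine ⟨LinearEquiv.ofInjectiveEndo G hinj, ?_, fun x hx => ?_⟩
  · have : ρ e = 0 := Subtype.ext (by rw [hρ, hφe, one_smul, sub_self]; rfl)
    rw [LinearEquiv.coe_ofInjectiveEndo, hG, this, hφe]
    simp
  · rw [LinearEquiv.coe_ofInjectiveEndo, hGi, hφP x hx]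

lemma linearIndependent_append {n : ℕ} {V : Submodule Λ (Hyp Λ n)}
    (b : Module.Basis (Fin n) Λ V) (hV : V ⊓ dualLagrangian Λ n = ⊥) :
    LinearIndependent Λ (Fin.append (fun i => (b i : Hyp Λ n))
      (fun i => ((0, Pi.single i 1) : Hyp Λ n))) := by
  have h1 : LinearIndependent Λ (fun i => (b i : Hyp Λ n)) :=
    b.linearIndependent.map' V.subtype V.ker_subtype
  have h2 : LinearIndependent Λ (fun i => ((0, Pi.single i 1) : Hyp Λ n)) := by
    have := (Pi.basisFun Λ (Fin n)).linearIndependent.map'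
      (LinearMap.inr Λ (Fin n → Λ) (Fin n → Λ)) (LinearMap.ker_eq_bot.2 LinearMap.inr_injective)
    simpa [Function.comp_def] using this
  have h3 := h1.sum_type h2 ((disjoint_iff.2 hV).mono
    (Submodule.span_le.2 (by rintro _ ⟨i, rfl⟩; exact (b i).2))
    (Submodule.span_le.2 (by rintro _ ⟨i, rfl⟩; exact ⟨rfl, trivial⟩)))
  rw [← linearIndependent_equiv finSumFinEquiv]
  have heq : Fin.append (fun i => (b i : Hyp Λ n)) (fun i => ((0, Pi.single i 1) : Hyp Λ n)) ∘
      finSumFinEquiv = Sum.elim (fun i => (b i : Hyp Λ n)) (fun i => (0, Pi.single i 1)) := by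
    funext i
    cases i with
    | inl i => exact Fin.append_left _ _ i
    | inr i => exact Fin.append_right _ _ i
  rw [heq]
  exact h3

lemma Pair.isElementary_of_inf_eq_bot {p : Pair Λ}
    (h : p.V ⊓ dualLagrangian Λ p.k = ⊥) :
    p.IsElementary (⊤ : AddSubgroup (ReducedK1 Λ)) := by
  have hli := linearIndependent_append p.basis h
  have hcard : Fintype.card (Fin (p.k + p.k)) = Module.finrank Λ (Hyp Λ p.k) := by simp
  refine ⟨IsCompl.of_eq h ?_, isSimpleMatrix_top ?_⟩
  · rw [eq_top_iff, ← hli.span_eq_top_of_card_eq_finrank' hcard, Submodule.span_le]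
    rintro _ ⟨i, rfl⟩
    refine Fin.addCases (fun i => ?_) (fun i => ?_) i
    · rw [Fin.append_left]
      exact Submodule.mem_sup_left (p.basis i).2
    · rw [Fin.append_right]
      exact Submodule.mem_sup_right ⟨rfl, trivial⟩
  · rw [← coe_basisOfLinearIndependentOfCardEqFinrank' _ hli hcard]
    exact IsUnit.of_mul_eq_one _ (Module.Basis.toMatrix_mul_toMatrix_flip _ _)

variable [StarRing Λ]

/-- Some product of a hyperbolic isometry and a flip decreases the intersection of a
half-dimensional subspace with `{0} × Λ^n`. -/
lemma exists_mem_RU_finrank_inf_lt (q : ℕ) {n : ℕ} (W : Submodule Λ (Hyp Λ n))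
    (hW : Module.finrank Λ W = n) (hne : W ⊓ dualLagrangian Λ n ≠ ⊥) :
    ∃ τ ∈ RU q (⊤ : AddSubgroup (ReducedK1 Λ)) n,
      Module.finrank Λ (W.map τ.toLinearMap ⊓ dualLagrangian Λ n : Submodule Λ (Hyp Λ n)) <
        Module.finrank Λ (W ⊓ dualLagrangian Λ n : Submodule Λ (Hyp Λ n)) := by
  obtain ⟨u, ⟨huW, hu1, -⟩, hu0⟩ := (Submodule.ne_bot_iff _).1 hne
  have hu1 : u.1 = 0 := hu1
  have hu2 : u.2 ≠ 0 := fun h => hu0 (Prod.ext hu1 h)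
  obtain ⟨j, hj⟩ := Function.ne_iff.1 hu2
  have hn : 0 < n := j.pos
  set P := W.map (LinearMap.fst Λ (Fin n → Λ) (Fin n → Λ)) with hP
  have hPtop : ∃ e, e ∉ P := by
    by_contra! h
    have hsurj : Function.Surjective
        ((LinearMap.fst Λ (Fin n → Λ) (Fin n → Λ)).domRestrict W) := fun y => by
      obtain ⟨w, hw, rfl⟩ := h y
      exact ⟨⟨w, hw⟩, rfl⟩
    -- A surjection between spaces of dimension `n` is injective, but `u` is in the kernel.
    have hinj := (LinearMap.injective_iff_surjective_of_finrank_eq_finrank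
      (by rw [hW, Module.finrank_fin_fun])).2 hsurj
    have : (⟨u, huW⟩ : W) = 0 := hinj (by simpa using hu1)
    exact hu0 (congrArg Subtype.val this)
  -- A vector space is not the union of two proper subspaces.
  have hex : ∃ e, e ∉ P ∧ star u.2 ⬝ᵥ e ≠ 0 := by
    obtain ⟨e₁, he₁⟩ := hPtop
    by_cases h1 : star u.2 ⬝ᵥ e₁ = 0
    · have h2 : star u.2 ⬝ᵥ (Pi.single j 1) ≠ 0 := by simpa using hj
      by_cases h3 : Pi.single j 1 ∈ P
      · exact ⟨e₁ + Pi.single j 1, fun h => he₁ ((P.add_mem_iff_left h3).1 h), by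
          rwa [dotProduct_add, h1, zero_add]⟩
      · exact ⟨_, h3, h2⟩
    · exact ⟨e₁, he₁, h1⟩
  obtain ⟨e, heP, hue⟩ := hex
  obtain ⟨g, hge, hgP⟩ := exists_linearEquiv_single ⟨0, hn⟩ P heP
  have hg : hyperbolicEquiv g ∈ RU q (⊤ : AddSubgroup (ReducedK1 Λ)) n :=
    Subgroup.subset_closure (Or.inl (hyperbolicEquiv_mem_TU q g))
  have hf : flip q ⟨0, hn⟩ ∈ RU q (⊤ : AddSubgroup (ReducedK1 Λ)) n :=
    Subgroup.subset_closure (Or.inr ⟨hn, rfl⟩)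
  refine ⟨_, mul_mem hf hg, ?_⟩
  set τ : Hyp Λ n ≃ₗ[Λ] Hyp Λ n := flip q ⟨0, hn⟩ * hyperbolicEquiv g with hτ
  have hτfst : ∀ w j, (τ w).1 j =
      if j = ⟨0, hn⟩ then (hyperbolicEquiv g w).2 j else g w.1 j := fun w j => rfl
  have hτ0 : ∀ w, (τ w).1 = 0 → star w.2 ⬝ᵥ e = 0 := fun w h => by
    have h0 : (hyperbolicEquiv g w).2 ⟨0, hn⟩ = 0 := by
      simpa [h] using (hτfst w ⟨0, hn⟩).symm
    rw [← g.symm_apply_apply e, hge, ← star_hyperbolicEquiv_snd]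
    simp [h0]
  have hle : W.map τ.toLinearMap ⊓ dualLagrangian Λ n <
      (W ⊓ dualLagrangian Λ n).map τ.toLinearMap := by
    refine lt_of_le_of_ne ?_ fun h => ?_
    · rintro _ ⟨⟨w, hw, rfl⟩, hd, -⟩
      have hd : (τ w).1 = 0 := hd
      refine ⟨w, ⟨hw, ?_, trivial⟩, rfl⟩
      -- Coordinate `0` vanishes by the choice of `g`; the flip leaves the others in place.
      have : g w.1 = 0 := by
        ext j
        by_cases hj0 : j = ⟨0, hn⟩
        · rw [hj0]; exact hgP _ ⟨w, hw, rfl⟩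
        · simpa [hd, hj0] using (hτfst w j).symm
      exact (LinearEquiv.map_eq_zero_iff g).1 this
    · have hu : τ u ∈ (W ⊓ dualLagrangian Λ n).map τ.toLinearMap :=
        ⟨u, ⟨huW, hu1, trivial⟩, rfl⟩
      rw [← h] at hu
      exact hue (hτ0 u hu.2.1)
  exact (Submodule.finrank_lt_finrank_of_lt hle).trans_eq (LinearEquiv.finrank_map_eq τ _)

/-- `RU_n` moves every half-dimensional subspace to one that meets `{0} × Λ^n` trivially. -/
lemma exists_mem_RU_map_inf_eq_bot (q : ℕ) {n : ℕ} (W : Submodule Λ (Hyp Λ n))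
    (hW : Module.finrank Λ W = n) :
    ∃ τ ∈ RU q (⊤ : AddSubgroup (ReducedK1 Λ)) n,
      W.map τ.toLinearMap ⊓ dualLagrangian Λ n = ⊥ := by
  induction h : Module.finrank Λ (W ⊓ dualLagrangian Λ n : Submodule Λ (Hyp Λ n))
    using Nat.strong_induction_on generalizing W with
  | _ d ih =>
    by_cases hne : W ⊓ dualLagrangian Λ n = ⊥
    · refine ⟨1, one_mem _, ?_⟩
      rw [← hne]
      exact congrArg (· ⊓ _) (Submodule.map_id W)
    · obtain ⟨τ, hτ, hlt⟩ := exists_mem_RU_finrank_inf_lt q W hW hne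
      obtain ⟨τ', hτ', h'⟩ := ih _ (h ▸ hlt) (W.map τ.toLinearMap)
        ((LinearEquiv.finrank_map_eq τ W).trans hW) rfl
      refine ⟨τ' * τ, mul_mem hτ' hτ, ?_⟩
      rw [← h', ← Submodule.map_comp]
      rfl

end Field

end KreckMonoid

theorem mainTheorem9 {Λ : Type*} [Field Λ] [StarRing Λ]
    (hΛ : ringChar Λ ≠ 2 ∨ Nonempty (Λ ≃+* ZMod 2)) (q : ℕ)
    (x : KreckMonoid.OddMonoid Λ q (⊤ : AddSubgroup (KreckMonoid.ReducedK1 Λ))) :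
    x.IsElementary := by
  open KreckMonoid in
  obtain ⟨p, rfl⟩ := Quot.exists_rep x
  obtain ⟨τ, hτ, h⟩ := exists_mem_RU_map_inf_eq_bot q p.V
    (by rw [Module.finrank_eq_card_basis p.basis, Fintype.card_fin])
  let p' : Pair Λ := ⟨p.k, p.V.map τ.toLinearMap, p.basis.map (τ.submoduleMap p.V),
    Submodule.exists_isCompl _⟩
  -- The basis is transported along `τ`, so the change of basis is the identity.
  refine ⟨p', (Quot.sound ⟨p.k, le_rfl, le_rfl, τ, hτ, 1, isSimpleMatrix_top isUnit_one,
    fun i => ?_⟩).symm, Pair.isElementary_of_inf_eq_bot h⟩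
  have hbasis : ∀ j, p'.stabBasis p.k j = τ (p.stabBasis p.k j) := fun j => by
    rw [stabBasis_self p]
    exact stabBasis_self p' j
  change τ (p.stabBasis p.k i) = ∑ j, (1 : Matrix _ _ Λ) j i • p'.stabBasis p.k j
  simp [hbasis, Matrix.one_apply]
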